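/- Let $d\in\mathbb N$, $1<\alpha\le 2$, $\nu\in[-1,1]$ and $d/\alpha<\beta<d$. Let $c=(c_k)_{k\in\mathbb Z^d}$ be real with $\sum_k|c_k|^\alpha<\infty$ and $$\lim_{t\to\infty}\ \sup_{|x|=1}\bigl|t^\beta c_{[tx]}-p(x)\bigr|=0,$$ where $[\cdot]$ is the coordinatewise integer part and $p:\mathbb R^d\setminus\{0\}\to\mathbb R$ is locally integrable and homogeneous of order $-\beta$, i.e. $p(tx)=t^{-\beta}p(x)$ for $t>0$. Put $\check p(x)=p(-x)$. A random noise on a linear space $\mathcal F$ of functions is a family of real random variables $(W[f])_{f\in\mathcal F}$ with $W[af+bg]=aW[f]+bW[g]$ a.s. for all $a,b\in\mathbb R$, $f,g\in\mathcal F$. For $\sigma\ge 0$ and $\nu\in[-1,1]$ let $S_\alpha(\sigma,\nu)$ be the law with characteristic function $\theta\mapsto\exp\bigl(-\sigma^\alpha|\theta|^\alpha(1-i\nu\,\mathrm{sgn}(\theta)\tan\frac{\pi\alpha}{2})\bigr)$; in particular $S_2(\sigma,\nu)=N(0,2\sigma^2)$. Let $W_\alpha$ be a stable white noise on $\mathbb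 R^d$ with Lebesgue control measure and constant skewness $\nu$: a random noise on $L^\alpha(\mathbb R^d)$ with $W_\alpha[f]\sim S_\alpha(\sigma_f,\nu_f)$, where $\sigma_f^\alpha=\int|f|^\alpha\,dx$ and $\sigma_f^\alpha\nu_f=\nu\int\mathrm{sgn}(f)|f|^\alpha\,dx$. For $f\in L^\alpha\cap L^1$ the convolution $(f*\check p)(x)=\int f(y)p(y-x)\,dy$ converges absolutely for a.e. $x$ and $f*\check p\in L^\alpha$. The fractional stable noise $W_{\alpha,p}[f]=W_\alpha[f*\check p]$ is therefore well defined, and it is a random noise on $L^\alpha\cap L^1$. Moreover: 1. $W_{\alpha,p}$ is $\alpha$-stable: all its finite-dimensional laws are $\alpha$-stable, and each $W_{\alpha,p}[f]$ has a law $S_\alpha(\sigma,\nu')$ for some $\sigma\ge0$, $\nu'\in[-1,1]$. It is stationary: for all $u\in\mathbb R^d$, $(W_{\alpha,p}[f(\cdot+u)])_f$ and $(W_{\alpha,p}[f])_f$ have the same finite-dimensional laws. It is self-similar of index $H=d/\alpha-\beta+d$: for all $h>0$, $(h^{H}W_{\alpha,p}[f(h\,\cdot)])_f$ and $(W_{\alpha,p}[f])_f$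 have the same finite-dimensional laws. Here $f$ ranges over $L^\alpha\cap L^1$. 2. Let $\alpha=2$ and $K(x,y)=\int_{\mathbb R^d}p(x-z)p(y-z)\,dz$, which converges absolutely for $x\ne y$. With the normalization above, $W_{2,p}$ is the centered Gaussian random noise with $$\mathbb E\bigl(W_{2,p}[f]W_{2,p}[g]\bigr)=2\int_{\mathbb R^d\times\mathbb R^d}f(x)K(x,y)g(y)\,dx\,dy,\qquad f,g\in L^1\cap L^2.$$ Equivalently, $\widetilde W=W_2/\sqrt2$ is isometric, $\mathbb E(\widetilde W[g]^2)=\int g^2\,dx$ for $g\in L^2$, and the noise $\widetilde W[f*\check p]$ driven by it is the centered Gaussian random noise with covariance $\int f(x)K(x,y)g(y)\,dx\,dy$, i.e. with kernel exactly $K$. All these double integrals converge absolutely. -/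

import Mathlib

open MeasureTheory ProbabilityTheory Filter Topology

noncomputable section

namespace StableNoise

/-- The linear space `L^q(E, m)` of real functions (not classes) with `∫ |f|^q dm < ∞`, `q > 0`. -/
def lpFunctions {E : Type*} [MeasurableSpace E] (q : ℝ) (m : Measure E) :
    Submodule ℝ (E → ℝ) where
  carrier := {f | MemLp f (ENNReal.ofReal q) m}
  add_mem' hf hg := MemLp.add hf hg
  zero_mem' := MemLp.zero'
  smul_mem' a _ hf := MemLp.const_smul hf a

/-- A random noise on `E` with space of integrands `F`: a family of real random variables
`(W f)_{f ∈ F}` that depends linearly on `f`, almost surely for each linear relation.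
The values of `W` outside `F` carry no information. -/
structure IsRandomNoise {E Ω : Type*} [MeasurableSpace Ω] (F : Submodule ℝ (E → ℝ))
    (W : (E → ℝ) → Ω → ℝ) (P : Measure Ω) : Prop where
  aemeasurable : ∀ f ∈ F, AEMeasurable (W f) P
  linear : ∀ f ∈ F, ∀ g ∈ F, ∀ a b : ℝ,
    W (a • f + b • g) =ᵐ[P] fun ω => a * W f ω + b * W g ω

/-- The Fourier transform of the stable distribution `S_α(σ, ν)`. -/
def stableCharFun (α σ ν θ : ℝ) : ℂ :=
  Complex.exp (-((σ ^ α * |θ| ^ α : ℝ) : ℂ) *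
    (1 - Complex.I * ((ν * Real.sign θ * Real.tan (Real.pi * α / 2) : ℝ) : ℂ)))

/-- The random variable `X` has the stable distribution `S_α(σ, ν)`. -/
def HasStableLaw {Ω : Type*} [MeasurableSpace Ω] (X : Ω → ℝ) (α σ ν : ℝ) (P : Measure Ω) : Prop :=
  AEMeasurable X P ∧ ∀ θ : ℝ, charFun (P.map X) θ = stableCharFun α σ ν θ

/-- The scale parameter `σ_f = (∫ |f|^α dm)^{1/α}`. -/
def scale {E : Type*} [MeasurableSpace E] (m : Measure E) (α : ℝ) (f : E → ℝ) : ℝ :=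
  (∫ x, |f x| ^ α ∂m) ^ (1 / α)

/-- The skewness parameter `ν_f`, with `σ_f^α ν_f = ∫ v ε(f) |f|^α dm` (and `ν_f = 0` in the
degenerate case `σ_f = 0`, where the law `S_α(0, ν_f)` does not depend on `ν_f`). -/
def skewness {E : Type*} [MeasurableSpace E] (m : Measure E) (α : ℝ) (v f : E → ℝ) : ℝ :=
  (∫ x, v x * Real.sign (f x) * |f x| ^ α ∂m) / ∫ x, |f x| ^ α ∂m

/-- `W` is the independently scattered `α`-stable noise with control measure `m` and skewness
function `v`: a random noise on `L^α(m)` with `W f ∼ S_α(σ_f, ν_f)`. -/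
structure IsStableWhiteNoise {E Ω : Type*} [MeasurableSpace E] [MeasurableSpace Ω]
    (m : Measure E) (α : ℝ) (v : E → ℝ) (W : (E → ℝ) → Ω → ℝ) (P : Measure Ω) : Prop where
  isRandomNoise : IsRandomNoise (lpFunctions α m) W P
  hasStableLaw : ∀ f ∈ lpFunctions α m, HasStableLaw (W f) α (scale m α f) (skewness m α v f) P

/-- A law `μ` on `ℝⁿ` is `α`-stable: if `X, X'` are independent with law `μ` then, for all
`A, B > 0`, `A X + B X'` has the law of `(A^α + B^α)^{1/α} X + D` for some vector `D`. -/
def IsStableLaw {n : ℕ} (α : ℝ) (μ : Measure (Fin n → ℝ)) : Prop :=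
  IsProbabilityMeasure μ ∧ ∀ A B : ℝ, 0 < A → 0 < B → ∃ D : Fin n → ℝ,
    (μ.map fun x => A • x) ∗ (μ.map fun x => B • x) =
      μ.map fun x => (A ^ α + B ^ α) ^ (1 / α) • x + D

/-- The process `(W f)_{f ∈ F}` is `α`-stable: all its finite-dimensional laws are `α`-stable. -/
def IsStableProcess {E Ω : Type*} [MeasurableSpace Ω] (α : ℝ) (F : Submodule ℝ (E → ℝ))
    (W : (E → ℝ) → Ω → ℝ) (P : Measure Ω) : Prop :=
  ∀ (n : ℕ) (f : Fin n → E → ℝ), (∀ i, f i ∈ F) →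
    AEMeasurable (fun ω i => W (f i) ω) P ∧ IsStableLaw α (P.map fun ω i => W (f i) ω)

/-- `(W f)_{f ∈ F}` and `(V f)_{f ∈ F}` have the same finite-dimensional laws. -/
def SameFiniteDimLaws {E Ω : Type*} [MeasurableSpace Ω] (F : Submodule ℝ (E → ℝ))
    (W V : (E → ℝ) → Ω → ℝ) (P : Measure Ω) : Prop :=
  ∀ (n : ℕ) (f : Fin n → E → ℝ), (∀ i, f i ∈ F) →
    IdentDistrib (fun ω i => W (f i) ω) (fun ω i => V (f i) ω) P P

/-- Stationarity: `F` is closed under translations, and `(W[f(· + u)])_{f ∈ F}` has the law of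
`(W[f])_{f ∈ F}` for every `u`. -/
def IsStationary {E Ω : Type*} [AddCommGroup E] [MeasurableSpace Ω]
    (F : Submodule ℝ (E → ℝ)) (W : (E → ℝ) → Ω → ℝ) (P : Measure Ω) : Prop :=
  (∀ (u : E), ∀ f ∈ F, (fun x => f (x + u)) ∈ F) ∧
  ∀ u : E, SameFiniteDimLaws F (fun f => W fun x => f (x + u)) W P

/-- Self-similarity of index `H`: `F` is closed under dilations, and `(h^H W[f(h ·)])_{f ∈ F}` has
the law of `(W[f])_{f ∈ F}` for every `h > 0`. -/
def IsSelfSimilar {E Ω : Type*} [AddCommGroup E] [Module ℝ E] [MeasurableSpace Ω]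
    (H : ℝ) (F : Submodule ℝ (E → ℝ)) (W : (E → ℝ) → Ω → ℝ) (P : Measure Ω) : Prop :=
  (∀ h : ℝ, 0 < h → ∀ f ∈ F, (fun x => f (h • x)) ∈ F) ∧
  ∀ h : ℝ, 0 < h →
    SameFiniteDimLaws F (fun f ω => h ^ H * W (fun x => f (h • x)) ω) W P

/-- `(W f)_{f ∈ F}` is the centered Gaussian noise with covariance
`E[W f W g] = ∫∫ f(x) K(x, y) g(y) dx dy`, the double integral being absolutely convergent. -/
structure IsCenteredGaussianNoise {E Ω : Type*} [MeasureSpace E] [MeasurableSpace Ω]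
    (F : Submodule ℝ (E → ℝ)) (W : (E → ℝ) → Ω → ℝ) (K : E → E → ℝ) (P : Measure Ω) : Prop where
  isRandomNoise : IsRandomNoise F W P
  isGaussianProcess : IsGaussianProcess (fun (f : F) ω => W (f : E → ℝ) ω) P
  centered : ∀ f ∈ F, ∫ ω, W f ω ∂P = 0
  integrable : ∀ f ∈ F, ∀ g ∈ F, Integrable fun z : E × E => f z.1 * K z.1 z.2 * g z.2
  covariance : ∀ f ∈ F, ∀ g ∈ F,
    ∫ ω, W f ω * W g ω ∂P = ∫ z : E × E, f z.1 * K z.1 z.2 * g z.2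

/-- The filter `c` on `ℤ^d` varies regularly at infinity with order `-β` and limit `p`:
`sup_{|x| = 1} |t^β c_{[t x]} - p x| → 0` as `t → ∞`, where `[·]` is the integer part taken
coordinate by coordinate, and `p` is a locally integrable function on `ℝ^d ∖ {0}` that is
homogeneous of order `-β`. -/
structure IsRegularlyVarying {d : ℕ} (β : ℝ) (c : (Fin d → ℤ) → ℝ)
    (p : EuclideanSpace ℝ (Fin d) → ℝ) : Prop where
  locallyIntegrable : LocallyIntegrableOn p {0}ᶜ
  homogeneous : ∀ t : ℝ, 0 < t → ∀ x, x ≠ 0 → p (t • x) = t ^ (-β) * p x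
  tendsto : TendstoUniformlyOn (fun (t : ℝ) x => t ^ β * c fun i => ⌊t * x i⌋) p atTop
    (Metric.sphere 0 1)

/-- `f ∗ p̌`, where `p̌ x = p (-x)`; that is, `(f ∗ p̌) x = ∫ f y p (y - x) dy`. -/
def convReflect {d : ℕ} (f p : EuclideanSpace ℝ (Fin d) → ℝ) : EuclideanSpace ℝ (Fin d) → ℝ :=
  convolution f (fun x => p (-x)) (ContinuousLinearMap.mul ℝ ℝ) volume

/-- The fractional noise `W_p[f] = W[f ∗ p̌]` driven by the noise `W`. -/
def fractionalNoise {d : ℕ} {Ω : Type*} (W : (EuclideanSpace ℝ (Fin d) → ℝ) → Ω → ℝ)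
    (p : EuclideanSpace ℝ (Fin d) → ℝ) (f : EuclideanSpace ℝ (Fin d) → ℝ) : Ω → ℝ :=
  W (convReflect f p)

/-- The kernel `K(x, y) = ∫ p(x - z) p(y - z) dz`. -/
def covKernel {d : ℕ} (p : EuclideanSpace ℝ (Fin d) → ℝ) (x y : EuclideanSpace ℝ (Fin d)) : ℝ :=
  ∫ z, p (x - z) * p (y - z)

end StableNoise

end

/-!
The argument has an analytic and a probabilistic half, joined by the map `f ↦ f ∗ p̌`.

The filter `c` is bounded, so its regular variation bounds the limit `p` on the unit sphere, and
homogeneity turns this into `|p x| ≤ C ‖x‖ ^ (-β)` (`IsRegularlyVarying.exists_abs_le`). Since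
`β < d`, the part of `p` in a ball about `0` is in `L^1`; since `β > d / α`, the rest is in `L^α`.
For `f ∈ L^α ∩ L^1`, Young's inequality (`lintegral_lconvolution_rpow_le`) in the forms
`L^α ∗ L^1 ⊆ L^α` and `L^1 ∗ L^α ⊆ L^α` therefore puts `|f| ∗ |p̌|` in `L^α`
(`lintegral_absConv_rpow_lt_top`), which gives both the almost everywhere convergence of the
convolution and `f ∗ p̌ ∈ L^α`.

For the white noise `W`, linearity turns `E exp (i ∑ θ_i W[f_i])` into `E exp (i W[∑ θ_i f_i])`, whose
logarithm `stableExponent` is `-∫ |g| ^ α` plus `i ν tan (π α / 2) ∫ sgn g |g| ^ α` for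
`g = ∑ θ_i f_i`. Hence all finite-dimensional laws can be compared through this one functional:
it is positively homogeneous of order `α` (stability), invariant under translations
(stationarity), and multiplied by `h ^ (-d)` under the dilation by `h`, while `f(h ·) ∗ p̌` is
`h ^ (β - d)` times the dilation of `f ∗ p̌` (self-similarity). A function that vanishes almost
everywhere has scale `0`, so `W` does not depend on versions, and `f ↦ W[f ∗ p̌]` is linear
although `f ↦ f ∗ p̌` is so only almost everywhere.

For `α = 2` the skewness term disappears, `W[g]` is centered Gaussian with variance `2 ∫ g ^ 2`, and
polarization with Fubini's theorem identifies the covariance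
`2 ∫ (f ∗ p̌) (g ∗ p̌) = 2 ∫∫ f(x) K(x, y) g(y)` (`integral_mul_covKernel_mul`). The triple integral
converges absolutely because `|f| ∗ |p̌|` and `|g| ∗ |p̌|` are in `L^2`.
-/

noncomputable section

namespace StableNoise

/-! ### Linearity of random noises -/

namespace IsRandomNoise

variable {E Ω ι : Type*} [MeasurableSpace Ω] {F : Submodule ℝ (E → ℝ)}
  {W : (E → ℝ) → Ω → ℝ} {P : Measure Ω} {f : E → ℝ}

lemma zero (hW : IsRandomNoise F W P) : W 0 =ᵐ[P] fun _ => 0 := by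
  have := hW.linear 0 F.zero_mem 0 F.zero_mem 0 0
  simpa using this

lemma smul (hW : IsRandomNoise F W P) (hf : f ∈ F) (a : ℝ) :
    W (a • f) =ᵐ[P] fun ω => a * W f ω := by
  have := hW.linear f hf 0 F.zero_mem a 0
  simpa using this

lemma sum (hW : IsRandomNoise F W P) (s : Finset ι) (f : ι → E → ℝ) (hf : ∀ i, f i ∈ F)
    (a : ι → ℝ) : W (∑ i ∈ s, a i • f i) =ᵐ[P] fun ω => ∑ i ∈ s, a i * W (f i) ω := by
  classical
  induction s using Finset.induction_on with
  | empty => simpa using hW.zero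
  | insert i s hi ih =>
    have hs : ∑ i ∈ s, a i • f i ∈ F := F.sum_mem fun i _ => F.smul_mem _ (hf i)
    have h := hW.linear (f i) (hf i) _ hs (a i) 1
    rw [one_smul] at h
    rw [Finset.sum_insert hi]
    filter_upwards [h, ih] with ω h1 h2
    rw [h1, h2, Finset.sum_insert hi, one_mul]

lemma aemeasurable_pi [Fintype ι] (hW : IsRandomNoise F W P) (f : ι → E → ℝ) (hf : ∀ i, f i ∈ F) :
    AEMeasurable (fun ω i => W (f i) ω) P :=
  aemeasurable_pi_iff.2 fun i => hW.aemeasurable _ (hf i)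

end IsRandomNoise

/-! ### Finite-dimensional laws of stable white noise -/

section WhiteNoise

variable {E Ω ι : Type*} [MeasurableSpace E] [MeasurableSpace Ω] [Fintype ι]
  {m : Measure E} {α ν : ℝ} {W : (E → ℝ) → Ω → ℝ} {P : Measure Ω} {f g : E → ℝ}

/-- The value at `1` of the logarithm of the characteristic function of `W[f]`, for the `α`-stable
white noise `W` with control measure `m` and constant skewness `ν`. -/
def stableExponent (m : Measure E) (α ν : ℝ) (f : E → ℝ) : ℂ :=
  -((∫ x, |f x| ^ α ∂m : ℝ) : ℂ) + Complex.I *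
    ((ν * Real.tan (Real.pi * α / 2) * ∫ x, Real.sign (f x) * |f x| ^ α ∂m : ℝ) : ℂ)

lemma abs_sign_le_one (r : ℝ) : |Real.sign r| ≤ 1 := by
  rcases Real.sign_apply_eq r with h | h | h <;> simp [h]

lemma abs_integral_sign_mul_le (m : Measure E) (α ν : ℝ) (f : E → ℝ)
    (hf : Integrable (fun x => |f x| ^ α) m) :
    |∫ x, ν * Real.sign (f x) * |f x| ^ α ∂m| ≤ |ν| * ∫ x, |f x| ^ α ∂m := by
  rw [← integral_const_mul, ← Real.norm_eq_abs]
  refine norm_integral_le_of_norm_le (hf.const_mul _) (ae_of_all _ fun x => ?_)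
  have h0 : 0 ≤ |f x| ^ α := by positivity
  rw [Real.norm_eq_abs, abs_mul, abs_mul, abs_of_nonneg h0]
  gcongr
  exact mul_le_of_le_one_right (abs_nonneg _) (abs_sign_le_one _)

lemma integrable_abs_rpow (hα : 0 < α) (hf : f ∈ lpFunctions α m) :
    Integrable (fun x => |f x| ^ α) m := by
  have := MemLp.integrable_norm_rpow (p := ENNReal.ofReal α) hf (by simpa using hα) (by simp)
  simpa [ENNReal.toReal_ofReal hα.le] using this

lemma skewness_mem_Icc (hα : 0 < α) (hν : ν ∈ Set.Icc (-1 : ℝ) 1) (hf : f ∈ lpFunctions α m) :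
    skewness m α (fun _ => ν) f ∈ Set.Icc (-1 : ℝ) 1 := by
  have h0 : 0 ≤ ∫ x, |f x| ^ α ∂m := integral_nonneg fun x => by positivity
  rw [Set.mem_Icc, ← abs_le, skewness, abs_div, abs_of_nonneg h0]
  refine div_le_one_of_le₀ ((abs_integral_sign_mul_le m α ν f (integrable_abs_rpow hα hf)).trans ?_)
    h0
  exact mul_le_of_le_one_left h0 (abs_le.2 hν)

lemma scale_nonneg (m : Measure E) (α : ℝ) (f : E → ℝ) : 0 ≤ scale m α f :=
  Real.rpow_nonneg (integral_nonneg fun x => by positivity) _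

lemma scale_rpow (hα : 0 < α) : scale m α f ^ α = ∫ x, |f x| ^ α ∂m := by
  rw [scale, ← Real.rpow_mul (integral_nonneg fun x => by positivity), one_div,
    inv_mul_cancel₀ hα.ne', Real.rpow_one]

/-- The skewed integral vanishes together with the scale, so the junk value of `skewness` at scale
`0` does no harm. -/
lemma stableCharFun_one (hα : 0 < α) (hf : f ∈ lpFunctions α m) :
    stableCharFun α (scale m α f) (skewness m α (fun _ => ν) f) 1 =
      Complex.exp (stableExponent m α ν f) := by
  have key : skewness m α (fun _ => ν) f * ∫ x, |f x| ^ α ∂m =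
      ν * ∫ x, Real.sign (f x) * |f x| ^ α ∂m := by
    rw [← integral_const_mul ν]
    simp_rw [skewness, ← mul_assoc]
    refine div_mul_cancel_of_imp fun h => ?_
    -- if `σ_f = 0` the skewed integral vanishes too
    have := abs_integral_sign_mul_le m α ν f (integrable_abs_rpow hα hf)
    rw [h, mul_zero] at this
    exact abs_nonpos_iff.1 this
  rw [stableCharFun, stableExponent, scale_rpow hα]
  congr 1
  have := congrArg (fun r : ℝ => (r : ℂ)) key
  push_cast at this ⊢
  simp only [Real.sign_one, abs_one, Real.one_rpow, Complex.ofReal_one]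
  linear_combination Complex.I * Complex.tan (Real.pi * α / 2) * this

lemma stableExponent_smul_of_pos (A : ℝ) (hA : 0 < A) (f : E → ℝ) :
    stableExponent m α ν (A • f) = (A ^ α : ℝ) * stableExponent m α ν f := by
  have hs : ∀ r : ℝ, Real.sign (A * r) = Real.sign r := fun r => by
    rcases lt_trichotomy r 0 with h | rfl | h
    · rw [Real.sign_of_neg h, Real.sign_of_neg (mul_neg_of_pos_of_neg hA h)]
    · simp
    · rw [Real.sign_of_pos h, Real.sign_of_pos (mul_pos hA h)]
  have h1 : ∀ r : ℝ, |A * r| ^ α = A ^ α * |r| ^ α := fun r => by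
    rw [abs_mul, abs_of_pos hA, Real.mul_rpow hA.le (abs_nonneg _)]
  have h2 : ∀ x, Real.sign (f x) * (A ^ α * |f x| ^ α) =
      A ^ α * (Real.sign (f x) * |f x| ^ α) := fun x => by ring
  simp only [stableExponent, Pi.smul_apply, smul_eq_mul, hs, h1, h2, integral_const_mul]
  push_cast
  ring

lemma dual_pi_apply [DecidableEq ι] (L : StrongDual ℝ (ι → ℝ)) (x : ι → ℝ) :
    L x = ∑ i, L (Pi.single i 1) * x i := by
  conv_lhs => rw [pi_eq_sum_univ' x]
  simp only [map_sum, map_smul, smul_eq_mul, mul_comm]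

namespace IsStableWhiteNoise

lemma charFun_map_one (hα : 0 < α) (hW : IsStableWhiteNoise m α (fun _ => ν) W P)
    (hf : f ∈ lpFunctions α m) :
    charFun (P.map (W f)) 1 = Complex.exp (stableExponent m α ν f) := by
  rw [(hW.hasStableLaw f hf).2, stableCharFun_one hα hf]

/-- By linearity, a functional of finitely many values of the noise is its value at one function. -/
lemma map_dual_map [DecidableEq ι] (hW : IsStableWhiteNoise m α (fun _ => ν) W P)
    (f : ι → E → ℝ) (hf : ∀ i, f i ∈ lpFunctions α m) (L : StrongDual ℝ (ι → ℝ)) :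
    (P.map fun ω i => W (f i) ω).map L = P.map (W (∑ i, L (Pi.single i 1) • f i)) := by
  rw [AEMeasurable.map_map_of_aemeasurable (by fun_prop)
    (hW.isRandomNoise.aemeasurable_pi f hf)]
  refine Measure.map_congr ?_
  filter_upwards [hW.isRandomNoise.sum Finset.univ f hf fun i => L (Pi.single i 1)] with ω h
  rw [h, Function.comp_apply, dual_pi_apply]

lemma charFunDual_map [DecidableEq ι] (hα : 0 < α)
    (hW : IsStableWhiteNoise m α (fun _ => ν) W P)
    (f : ι → E → ℝ) (hf : ∀ i, f i ∈ lpFunctions α m) (L : StrongDual ℝ (ι → ℝ)) :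
    charFunDual (P.map fun ω i => W (f i) ω) L =
      Complex.exp (stableExponent m α ν (∑ i, L (Pi.single i 1) • f i)) := by
  rw [charFunDual_eq_charFun_map_one, hW.map_dual_map f hf, hW.charFun_map_one hα
    (Submodule.sum_mem _ fun i _ => Submodule.smul_mem _ _ (hf i))]

/-- The exponents of the linear combinations determine the finite-dimensional laws. -/
lemma identDistrib [IsProbabilityMeasure P] (hα : 0 < α)
    (hW : IsStableWhiteNoise m α (fun _ => ν) W P)
    (f g : ι → E → ℝ) (hf : ∀ i, f i ∈ lpFunctions α m) (hg : ∀ i, g i ∈ lpFunctions α m)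
    (h : ∀ a : ι → ℝ, stableExponent m α ν (∑ i, a i • f i) =
      stableExponent m α ν (∑ i, a i • g i)) :
    IdentDistrib (fun ω i => W (f i) ω) (fun ω i => W (g i) ω) P P := by
  classical
  have h1 := hW.isRandomNoise.aemeasurable_pi f hf
  have h2 := hW.isRandomNoise.aemeasurable_pi g hg
  have := Measure.isProbabilityMeasure_map h1
  have := Measure.isProbabilityMeasure_map h2
  refine ⟨h1, h2, Measure.ext_of_charFunDual (funext fun L => ?_)⟩
  rw [hW.charFunDual_map hα f hf, hW.charFunDual_map hα g hg, h]

/-- The noise sees integrands only up to almost everywhere equality: the difference of two versions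
has scale `0`. -/
lemma ae_eq_of_ae_eq [IsProbabilityMeasure P] (hα : 0 < α)
    (hW : IsStableWhiteNoise m α (fun _ => ν) W P)
    (hf : f ∈ lpFunctions α m) (hg : g ∈ lpFunctions α m) (hfg : f =ᵐ[m] g) :
    W f =ᵐ[P] W g := by
  have hd : f - g ∈ lpFunctions α m := Submodule.sub_mem _ hf hg
  have h0 : ∀ᵐ x ∂m, |(f - g) x| ^ α = 0 := by
    filter_upwards [hfg] with x hx
    simp [hx, hα.ne']
  have hs : scale m α (f - g) = 0 := by
    rw [scale, integral_eq_zero_of_ae h0, Real.zero_rpow (by positivity)]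
  have hm := hW.isRandomNoise.aemeasurable _ hd
  have := Measure.isProbabilityMeasure_map hm
  have hlaw : P.map (W (f - g)) = Measure.dirac 0 := by
    refine Measure.ext_of_charFun (funext fun θ => ?_)
    rw [(hW.hasStableLaw _ hd).2, hs, charFun_dirac]
    simp [stableCharFun, Real.zero_rpow hα.ne']
  have hz : ∀ᵐ ω ∂P, W (f - g) ω = 0 := by
    refine ae_of_ae_map hm (p := fun r => r = 0) ?_
    rw [hlaw, ae_dirac_eq]
    rfl
  have hl := hW.isRandomNoise.linear f hf g hg 1 (-1)
  have he : (1 : ℝ) • f + (-1 : ℝ) • g = f - g := by ext x; simp [sub_eq_add_neg]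
  rw [he] at hl
  filter_upwards [hz, hl] with ω h1 h2
  linarith

/-- The exponent is homogeneous of order `α`, so the characteristic functions of `A X + B X'` and
of `(A ^ α + B ^ α) ^ (1 / α) X` agree. -/
lemma isStableLaw_map [IsProbabilityMeasure P] (hα : 0 < α)
    (hW : IsStableWhiteNoise m α (fun _ => ν) W P) {n : ℕ}
    (f : Fin n → E → ℝ) (hf : ∀ i, f i ∈ lpFunctions α m) :
    IsStableLaw α (P.map fun ω i => W (f i) ω) := by
  have hm := hW.isRandomNoise.aemeasurable_pi f hf
  have hp := Measure.isProbabilityMeasure_map hm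
  set μ := P.map fun ω i => W (f i) ω with hμ
  have hφ : ∀ A : ℝ, 0 < A → ∀ L, charFunDual (μ.map fun x => A • x) L =
      Complex.exp ((A ^ α : ℝ) *
        stableExponent m α ν (∑ i, L (Pi.single i 1) • f i)) := by
    intro A hA L
    have := MeasureTheory.charFunDual_map (μ := μ) (A • ContinuousLinearMap.id ℝ (Fin n → ℝ)) L
    have he : ((A • ContinuousLinearMap.id ℝ (Fin n → ℝ) : _ →L[ℝ] _) : _ → _) =
        fun x => A • x := rfl
    rw [he] at this
    rw [this, hW.charFunDual_map hα f hf, ← stableExponent_smul_of_pos A hA, Finset.smul_sum]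
    simp [mul_smul]
  have hpr : ∀ A : ℝ, IsProbabilityMeasure (μ.map fun x => A • x) := fun A =>
    Measure.isProbabilityMeasure_map (by fun_prop)
  refine ⟨hp, fun A B hA hB => ⟨0, ?_⟩⟩
  have := hpr A
  have := hpr B
  have := hpr ((A ^ α + B ^ α) ^ (1 / α))
  simp only [add_zero]
  have hAB : 0 < A ^ α + B ^ α := by positivity
  refine Measure.ext_of_charFunDual (funext fun L => ?_)
  rw [charFunDual_conv, hφ A hA, hφ B hB, hφ _ (by positivity), ← Complex.exp_add,
    ← Real.rpow_mul hAB.le, one_div, inv_mul_cancel₀ hα.ne', Real.rpow_one]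
  push_cast
  ring_nf

end IsStableWhiteNoise

end WhiteNoise

/-! ### The Gaussian white noise -/

section Gaussian

variable {E Ω ι : Type*} [MeasurableSpace E] [MeasurableSpace Ω] [Fintype ι]
  {m : Measure E} {ν : ℝ} {W : (E → ℝ) → Ω → ℝ} {P : Measure Ω} {f g : E → ℝ}

lemma mem_lpFunctions_two : f ∈ lpFunctions 2 m ↔ MemLp f 2 m := by
  change MemLp f (ENNReal.ofReal 2) m ↔ _
  rw [ENNReal.ofReal_ofNat]

lemma integral_add_sq (m : Measure E) (f g : E → ℝ) (hf : MemLp f 2 m) (hg : MemLp g 2 m) :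
    ∫ x, (f x + g x) ^ 2 ∂m =
      ∫ x, f x ^ 2 ∂m + 2 * ∫ x, f x * g x ∂m + ∫ x, g x ^ 2 ∂m := by
  have hfg : Integrable (fun x => 2 * (f x * g x)) m := (hf.integrable_mul hg).const_mul 2
  have h : Integrable (fun x => f x ^ 2 + 2 * (f x * g x)) m := hf.integrable_sq.add hfg
  rw [← integral_const_mul, ← integral_add hf.integrable_sq hfg, ← integral_add h hg.integrable_sq]
  congr with x
  ring

namespace IsStableWhiteNoise

/-- For `α = 2` the skewness drops out because `tan π = 0`. -/
lemma map_eq_gaussianReal [IsProbabilityMeasure P]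
    (hW : IsStableWhiteNoise m 2 (fun _ => ν) W P) (hf : f ∈ lpFunctions 2 m) :
    P.map (W f) = gaussianReal 0 (2 * ∫ x, f x ^ 2 ∂m).toNNReal := by
  have := Measure.isProbabilityMeasure_map (hW.isRandomNoise.aemeasurable f hf)
  refine Measure.ext_of_charFun (funext fun θ => ?_)
  have h0 : 0 ≤ 2 * ∫ x, f x ^ 2 ∂m :=
    mul_nonneg zero_le_two (integral_nonneg fun x => sq_nonneg _)
  have htan : Real.tan (Real.pi * 2 / 2) = 0 := by
    rw [mul_div_cancel_right₀ _ two_ne_zero, Real.tan_pi]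
  rw [(hW.hasStableLaw f hf).2, stableCharFun, charFun_gaussianReal, scale_rpow two_pos, htan,
    Real.coe_toNNReal _ h0]
  congr 1
  simp only [Real.rpow_ofNat, sq_abs]
  push_cast
  ring

lemma hasGaussianLaw [IsProbabilityMeasure P]
    (hW : IsStableWhiteNoise m 2 (fun _ => ν) W P) (hf : f ∈ lpFunctions 2 m) :
    HasGaussianLaw (W f) P :=
  ⟨by rw [hW.map_eq_gaussianReal hf]; infer_instance⟩

lemma integral_eq_zero [IsProbabilityMeasure P]
    (hW : IsStableWhiteNoise m 2 (fun _ => ν) W P) (hf : f ∈ lpFunctions 2 m) :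
    ∫ ω, W f ω ∂P = 0 := by
  have h := integral_map (hW.isRandomNoise.aemeasurable f hf)
    (f := fun x : ℝ => x) (by fun_prop)
  rw [← h, hW.map_eq_gaussianReal hf, integral_id_gaussianReal]

lemma integral_sq [IsProbabilityMeasure P]
    (hW : IsStableWhiteNoise m 2 (fun _ => ν) W P) (hf : f ∈ lpFunctions 2 m) :
    ∫ ω, W f ω ^ 2 ∂P = 2 * ∫ x, f x ^ 2 ∂m := by
  have hm := hW.isRandomNoise.aemeasurable f hf
  have h0 : 0 ≤ 2 * ∫ x, f x ^ 2 ∂m :=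
    mul_nonneg zero_le_two (integral_nonneg fun x => sq_nonneg _)
  rw [← variance_of_integral_eq_zero hm (hW.integral_eq_zero hf)]
  have h := variance_map (μ := P) (X := id) (by fun_prop) hm
  rw [Function.id_comp] at h
  rw [← h, hW.map_eq_gaussianReal hf, variance_id_gaussianReal, Real.coe_toNNReal _ h0]

lemma memLp_two [IsProbabilityMeasure P]
    (hW : IsStableWhiteNoise m 2 (fun _ => ν) W P) (hf : f ∈ lpFunctions 2 m) :
    MemLp (W f) 2 P :=
  (hW.hasGaussianLaw hf).memLp_two

/-- The isometry `E[W[f] ^ 2] = 2 ∫ f ^ 2`, polarized. -/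
lemma integral_mul [IsProbabilityMeasure P]
    (hW : IsStableWhiteNoise m 2 (fun _ => ν) W P)
    (hf : f ∈ lpFunctions 2 m) (hg : g ∈ lpFunctions 2 m) :
    ∫ ω, W f ω * W g ω ∂P = 2 * ∫ x, f x * g x ∂m := by
  have hfg : (1 : ℝ) • f + (1 : ℝ) • g ∈ lpFunctions 2 m :=
    Submodule.add_mem _ (Submodule.smul_mem _ _ hf) (Submodule.smul_mem _ _ hg)
  have h1 := hW.integral_sq hfg
  have h2 : ∫ ω, W ((1 : ℝ) • f + (1 : ℝ) • g) ω ^ 2 ∂P = ∫ ω, (W f ω + W g ω) ^ 2 ∂P := by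
    refine integral_congr_ae ?_
    filter_upwards [hW.isRandomNoise.linear f hf g hg 1 1] with ω h
    rw [h, one_mul, one_mul]
  have h3 := integral_add_sq P _ _ (hW.memLp_two hf) (hW.memLp_two hg)
  simp only [one_smul, Pi.add_apply] at h1 h2
  have h4 := integral_add_sq m _ _ (mem_lpFunctions_two.1 hf) (mem_lpFunctions_two.1 hg)
  have h5 := hW.integral_sq hf
  have h6 := hW.integral_sq hg
  linarith

lemma hasGaussianLaw_pi [IsProbabilityMeasure P]
    (hW : IsStableWhiteNoise m 2 (fun _ => ν) W P)
    (f : ι → E → ℝ) (hf : ∀ i, f i ∈ lpFunctions 2 m) :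
    HasGaussianLaw (fun ω i => W (f i) ω) P := by
  classical
  refine ⟨isGaussian_of_map_eq_gaussianReal fun L =>
    ⟨0, (2 * ∫ x, (∑ i, L (Pi.single i 1) • f i) x ^ 2 ∂m).toNNReal, ?_⟩⟩
  rw [hW.map_dual_map f hf, hW.map_eq_gaussianReal
    (Submodule.sum_mem _ fun i _ => Submodule.smul_mem _ _ (hf i))]

end IsStableWhiteNoise

lemma IsCenteredGaussianNoise.const_mul {E : Type*} [MeasureSpace E] {F : Submodule ℝ (E → ℝ)}
    {W : (E → ℝ) → Ω → ℝ} {K : E → E → ℝ} (h : IsCenteredGaussianNoise F W K P) (s : ℝ) :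
    IsCenteredGaussianNoise F (fun f ω => s * W f ω) (fun x y => s ^ 2 * K x y) P := by
  obtain ⟨hnoise, hgauss, hcent, hint, hcov⟩ := h
  have h1 : ∀ f g ω, s * W f ω * (s * W g ω) = s ^ 2 * (W f ω * W g ω) := fun f g ω => by ring
  have h2 : ∀ f g : E → ℝ, ∀ z : E × E, f z.1 * (s ^ 2 * K z.1 z.2) * g z.2 =
      s ^ 2 * (f z.1 * K z.1 z.2 * g z.2) := fun f g z => by ring
  refine ⟨⟨fun f hf => (hnoise.aemeasurable f hf).const_mul s, fun f hf g hg a b => ?_⟩,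
    hgauss.smul fun _ => s, fun f hf => ?_, fun f hf g hg => ?_, fun f hf g hg => ?_⟩
  · filter_upwards [hnoise.linear f hf g hg a b] with ω hω
    rw [hω]
    ring
  · rw [integral_const_mul, hcent f hf, mul_zero]
  · simp_rw [h2]
    exact (hint f hf g hg).const_mul (s ^ 2)
  · simp_rw [h1, h2, integral_const_mul, hcov f hf g hg]

end Gaussian

/-! ### Young's inequality -/

section Young

variable {G : Type*} [AddGroup G] [MeasurableSpace G] [MeasurableAdd₂ G] [MeasurableNeg G]
  {μ : Measure G} [μ.IsAddLeftInvariant] [SFinite μ]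

/-- Young's inequality `L^1 ∗ L^a ⊆ L^a`. -/
lemma lintegral_lconvolution_rpow_le {a : ℝ} (ha : 1 < a) {f g : G → ENNReal}
    (hf : AEMeasurable f μ) (hg : AEMeasurable g μ) :
    ∫⁻ x, (lconvolution f g μ x) ^ a ∂μ ≤ (∫⁻ x, f x ∂μ) ^ a * ∫⁻ x, g x ^ a ∂μ := by
  have hq : a.HolderConjugate a.conjExponent := .conjExponent ha
  set q := a.conjExponent
  have ha0 : 0 < a := hq.pos
  have hq0 : 0 < q := hq.symm.pos
  have hsum : 1 / q + 1 / a = 1 := by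
    have := hq.inv_add_inv_eq_one
    rw [one_div, one_div]
    linarith
  have haq : 1 / q * a + 1 = a := by
    have : (1 / q + 1 / a) * a = a := by rw [hsum, one_mul]
    rwa [add_mul, one_div_mul_cancel ha0.ne'] at this
  -- Hölder for `f h = f ^ (1 / q) * (f ^ (1 / a) h)`
  have holder : ∀ x, lconvolution f g μ x ^ a ≤
      (∫⁻ y, f y ∂μ) ^ (1 / q * a) * ∫⁻ y, f y * g (-y + x) ^ a ∂μ := by
    intro x
    have hgx : AEMeasurable (fun y => g (-y + x)) μ := by fun_prop
    have h := ENNReal.lintegral_mul_le_Lp_mul_Lq μ hq.symm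
      (f := fun y => f y ^ (1 / q)) (g := fun y => f y ^ (1 / a) * g (-y + x))
      (by fun_prop) (by fun_prop)
    have e1 : ∀ y, ((fun y => f y ^ (1 / q)) * fun y => f y ^ (1 / a) * g (-y + x)) y =
        f y * g (-y + x) := fun y => by
      rw [Pi.mul_apply, ← mul_assoc, ← ENNReal.rpow_add_of_nonneg _ _ (by positivity)
        (by positivity), hsum, ENNReal.rpow_one]
    have e2 : ∀ y, (f y ^ (1 / q)) ^ q = f y := fun y => by
      rw [← ENNReal.rpow_mul, one_div_mul_cancel hq0.ne', ENNReal.rpow_one]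
    have e3 : ∀ y, (f y ^ (1 / a) * g (-y + x)) ^ a = f y * g (-y + x) ^ a := fun y => by
      rw [ENNReal.mul_rpow_of_nonneg _ _ ha0.le, ← ENNReal.rpow_mul,
        one_div_mul_cancel ha0.ne', ENNReal.rpow_one]
    simp only [e1, e2, e3] at h
    calc lconvolution f g μ x ^ a
        ≤ ((∫⁻ y, f y ∂μ) ^ (1 / q) * (∫⁻ y, f y * g (-y + x) ^ a ∂μ) ^ (1 / a)) ^ a :=
          ENNReal.rpow_le_rpow h ha0.le
      _ = _ := by
          rw [ENNReal.mul_rpow_of_nonneg _ _ ha0.le, ← ENNReal.rpow_mul, ← ENNReal.rpow_mul,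
            one_div_mul_cancel ha0.ne', ENNReal.rpow_one]
  have hint : AEMeasurable (fun x => ∫⁻ y, f y * g (-y + x) ^ a ∂μ) μ := by
    have : AEMeasurable (fun x => g x ^ a) μ := by fun_prop
    exact aemeasurable_lconvolution hf this
  calc ∫⁻ x, (lconvolution f g μ x) ^ a ∂μ
      ≤ ∫⁻ x, (∫⁻ y, f y ∂μ) ^ (1 / q * a) * ∫⁻ y, f y * g (-y + x) ^ a ∂μ ∂μ :=
        lintegral_mono holder
    _ = (∫⁻ y, f y ∂μ) ^ (1 / q * a) * ((∫⁻ y, f y ∂μ) * ∫⁻ x, g x ^ a ∂μ) := by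
        rw [lintegral_const_mul'' _ hint, lintegral_lintegral_swap (by fun_prop)]
        congr 1
        have : ∀ y, ∫⁻ x, f y * g (-y + x) ^ a ∂μ = f y * ∫⁻ x, g x ^ a ∂μ := fun y => by
          have hgy : AEMeasurable (fun x => g (-y + x)) μ :=
            hg.comp_quasiMeasurePreserving
              (measurePreserving_add_left μ (-y)).quasiMeasurePreserving
          rw [lintegral_const_mul'' _ (hgy.pow_const a),
            lintegral_add_left_eq_self (fun x => g x ^ a)]
        simp_rw [this]
        rw [lintegral_mul_const'' _ hf]
    _ = _ := by
        rw [← mul_assoc]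
        congr 1
        nth_rewrite 2 [← ENNReal.rpow_one (∫⁻ y, f y ∂μ)]
        rw [← ENNReal.rpow_add_of_nonneg _ _ (by positivity) zero_le_one, haq]

end Young

/-! ### Kernels bounded by a negative power of the norm -/

section PowerKernel

lemma abs_indicator_compl_ball_le {E : Type*} [NormedAddCommGroup E] {p : E → ℝ} {C β r : ℝ}
    (hβ0 : 0 ≤ β) (hr : 0 < r)
    (hC : ∀ x, x ≠ 0 → |p x| ≤ C * ‖x‖ ^ (-β)) (x : E) :
    |(Metric.ball 0 r)ᶜ.indicator p x| ≤ |C| * r ^ (-β) := by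
  by_cases hx : x ∈ (Metric.ball (0 : E) r)ᶜ
  · have hxr : r ≤ ‖x‖ := by simpa using hx
    have hx0 : 0 < ‖x‖ := hr.trans_le hxr
    rw [Set.indicator_of_mem hx]
    refine (hC x (norm_pos_iff.1 hx0)).trans ?_
    exact mul_le_mul (le_abs_self C) (Real.rpow_le_rpow_of_nonpos hr hxr (neg_nonpos.2 hβ0))
      (by positivity) (abs_nonneg C)
  · rw [Set.indicator_of_notMem hx, abs_zero]
    positivity

variable {E : Type*} [NormedAddCommGroup E] [NormedSpace ℝ E] [FiniteDimensional ℝ E]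
  [MeasurableSpace E] [BorelSpace E] {μ : Measure E} [μ.IsAddHaarMeasure]
  {p : E → ℝ} {C β r : ℝ}

lemma integrable_indicator_ball (hd : 1 ≤ Module.finrank ℝ E) (hβ : β < Module.finrank ℝ E)
    (hm : AEStronglyMeasurable p μ) (hC : ∀ x, x ≠ 0 → |p x| ≤ C * ‖x‖ ^ (-β)) :
    Integrable ((Metric.ball 0 r).indicator p) μ := by
  rw [integrable_indicator_iff measurableSet_ball]
  have : Nontrivial E := Module.nontrivial_of_finrank_pos (R := ℝ) hd
  refine integrableOn_ball_of_norm_le_rpow hd hβ (C := C) (ae_restrict_of_ae ?_) hm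
  filter_upwards [compl_mem_ae_iff.2 (measure_singleton (μ := μ) (0 : E))] with x hx
  exact hC x hx

lemma memLp_indicator_compl_ball {α : ℝ} (hα : 0 < α) (hβ0 : 0 ≤ β)
    (hβ : Module.finrank ℝ E < β * α) (hr : 0 < r)
    (hm : AEStronglyMeasurable p μ) (hC : ∀ x, x ≠ 0 → |p x| ≤ C * ‖x‖ ^ (-β)) :
    MemLp ((Metric.ball 0 r)ᶜ.indicator p) (ENNReal.ofReal α) μ := by
  have hm' : AEStronglyMeasurable ((Metric.ball 0 r)ᶜ.indicator p) μ :=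
    hm.indicator measurableSet_ball.compl
  -- outside the ball, `‖x‖` is comparable with `1 + ‖x‖`
  have hbig : MemLp (fun x : E => |C| * (r⁻¹ + 1) ^ β * (1 + ‖x‖) ^ (-β)) (ENNReal.ofReal α) μ := by
    refine MemLp.const_mul ?_ _
    rw [← integrable_norm_rpow_iff (Measurable.aestronglyMeasurable (by fun_prop))
      (by simpa using hα) (by simp),
      ENNReal.toReal_ofReal hα.le]
    refine (integrable_one_add_norm (μ := μ) hβ).congr (ae_of_all _ fun x => ?_)
    have h1 : 0 ≤ 1 + ‖x‖ := by positivity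
    simp only
    rw [Real.norm_of_nonneg (by positivity), ← Real.rpow_mul h1, neg_mul]
  refine hbig.mono hm' (ae_of_all _ fun x => ?_)
  by_cases hx : x ∈ (Metric.ball (0 : E) r)ᶜ
  · have hxr : r ≤ ‖x‖ := by simpa using hx
    have hx0 : 0 < ‖x‖ := hr.trans_le hxr
    have h1 : 0 < 1 + ‖x‖ := by positivity
    rw [Set.indicator_of_mem hx, Real.norm_eq_abs, Real.norm_of_nonneg (by positivity), mul_assoc]
    refine (hC x (norm_pos_iff.1 hx0)).trans ?_
    refine mul_le_mul (le_abs_self C) ?_ (by positivity) (abs_nonneg C)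
    rw [Real.rpow_neg hx0.le, Real.rpow_neg h1.le, ← div_eq_mul_inv, ← one_div, div_le_div_iff₀
      (by positivity) (by positivity), one_mul, ← Real.mul_rpow (by positivity) hx0.le]
    refine Real.rpow_le_rpow h1.le ?_ hβ0
    have : 1 ≤ r⁻¹ * ‖x‖ := by
      rw [inv_mul_eq_div]
      exact (one_le_div hr).2 hxr
    linarith
  · rw [Set.indicator_of_notMem hx, norm_zero]
    positivity

/-- The balls of radius `‖x - y‖ / 2` about `x` and `y` are disjoint, so at each `z` at most one of
the two factors is singular. -/
lemma integrable_mul_comp_sub {x y : E} (hd : 1 ≤ Module.finrank ℝ E)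
    (hβ0 : 0 ≤ β) (hβ : β < Module.finrank ℝ E) (hβ2 : Module.finrank ℝ E < β * 2)
    (hm : AEStronglyMeasurable p μ) (hC : ∀ x, x ≠ 0 → |p x| ≤ C * ‖x‖ ^ (-β)) (hxy : x ≠ y) :
    Integrable (fun z => p (x - z) * p (y - z)) μ := by
  set r := ‖x - y‖ / 2 with hr_def
  have hr : 0 < r := by
    have := norm_pos_iff.2 (sub_ne_zero.2 hxy)
    positivity
  set p₁ := (Metric.ball 0 r).indicator p with hp₁
  set p₂ := (Metric.ball 0 r)ᶜ.indicator p with hp₂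
  have hp : ∀ w, p w = p₁ w + p₂ w := fun w => (Set.indicator_self_add_compl_apply _ p w).symm
  have h1 : Integrable p₁ μ := integrable_indicator_ball hd hβ hm hC
  have h2 : MemLp p₂ 2 μ := by
    have := memLp_indicator_compl_ball two_pos hβ0 hβ2 hr hm hC
    rwa [ENNReal.ofReal_ofNat] at this
  have hb : ∀ w, ‖p₂ w‖ ≤ |C| * r ^ (-β) := abs_indicator_compl_ball_le hβ0 hr hC
  have h1' : ∀ w, Integrable (fun z => p₁ (w - z)) μ := fun w => h1.comp_sub_left w
  have h2' : ∀ w, MemLp (fun z => p₂ (w - z)) 2 μ := fun w =>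
    h2.comp_measurePreserving (Measure.measurePreserving_sub_left μ w)
  have h0 : ∀ z, p₁ (x - z) * p₁ (y - z) = 0 := by
    intro z
    by_contra h
    have hx : ‖x - z‖ < r := by
      simpa using Set.mem_of_indicator_ne_zero (left_ne_zero_of_mul h)
    have hy : ‖y - z‖ < r := by
      simpa using Set.mem_of_indicator_ne_zero (right_ne_zero_of_mul h)
    have := norm_sub_le (x - z) (y - z)
    rw [sub_sub_sub_cancel_right] at this
    linarith
  have e : ∀ z, p (x - z) * p (y - z) = p₁ (x - z) * p₂ (y - z) + p₂ (x - z) * p₁ (y - z) +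
      p₂ (x - z) * p₂ (y - z) := fun z => by
    rw [hp, hp]
    linear_combination h0 z
  simp_rw [e]
  exact (((h1' x).mul_bdd (h2' y).1 (ae_of_all _ fun z => hb _)).add
    ((h1' y).bdd_mul (h2' x).1 (ae_of_all _ fun z => hb _))).add ((h2' x).integrable_mul (h2' y))

end PowerKernel

/-! ### The kernel `p` and the functions `f ∗ p̌` -/

section FractionalKernel

variable {d : ℕ} {α β C : ℝ} {c : (Fin d → ℤ) → ℝ} {f g p : EuclideanSpace ℝ (Fin d) → ℝ}

/-- The uniform limit on the unit sphere is bounded because the filter `c` is, and homogeneity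
spreads the bound to the whole space. -/
lemma IsRegularlyVarying.exists_abs_le (hα : 0 < α) (hc : Summable fun k => |c k| ^ α)
    (hp : IsRegularlyVarying β c p) : ∃ C : ℝ, ∀ x, x ≠ 0 → |p x| ≤ C * ‖x‖ ^ (-β) := by
  have hcb : ∀ k, |c k| ≤ (∑' k, |c k| ^ α) ^ (1 / α) := fun k => by
    have h := hc.le_tsum k fun j _ => by positivity
    calc |c k| = (|c k| ^ α) ^ (1 / α) := by
          rw [← Real.rpow_mul (abs_nonneg _), mul_one_div_cancel hα.ne', Real.rpow_one]
      _ ≤ _ := Real.rpow_le_rpow (by positivity) h (by positivity)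
  obtain ⟨t, ht, ht0⟩ := ((Metric.tendstoUniformlyOn_iff.1 hp.tendsto 1 one_pos).and
    (eventually_gt_atTop 0)).exists
  refine ⟨1 + t ^ β * (∑' k, |c k| ^ α) ^ (1 / α), fun x hx => ?_⟩
  have hx0 : 0 < ‖x‖ := norm_pos_iff.2 hx
  have hu : ‖x‖⁻¹ • x ∈ Metric.sphere (0 : EuclideanSpace ℝ (Fin d)) 1 := by
    rw [mem_sphere_zero_iff_norm, norm_smul, norm_inv, norm_norm, inv_mul_cancel₀ hx0.ne']
  have hu0 : ‖x‖⁻¹ • x ≠ 0 := smul_ne_zero (inv_ne_zero hx0.ne') hx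
  have hsphere : |p (‖x‖⁻¹ • x)| ≤ 1 + t ^ β * (∑' k, |c k| ^ α) ^ (1 / α) := by
    have h1 := ht _ hu
    rw [Real.dist_eq] at h1
    have h2 : |t ^ β * c fun i => ⌊t * (‖x‖⁻¹ • x) i⌋| ≤ t ^ β * (∑' k, |c k| ^ α) ^ (1 / α) := by
      rw [abs_mul, abs_of_nonneg (by positivity)]
      exact mul_le_mul_of_nonneg_left (hcb _) (by positivity)
    have h3 := abs_sub_abs_le_abs_sub (p (‖x‖⁻¹ • x)) (t ^ β * c fun i => ⌊t * (‖x‖⁻¹ • x) i⌋)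
    linarith
  have hhom := hp.homogeneous ‖x‖ hx0 _ hu0
  rw [smul_inv_smul₀ hx0.ne'] at hhom
  rw [hhom, abs_mul, abs_of_nonneg (by positivity), mul_comm]
  exact mul_le_mul_of_nonneg_right hsphere (by positivity)

lemma IsRegularlyVarying.aestronglyMeasurable (hd : 1 ≤ d) (hp : IsRegularlyVarying β c p) :
    AEStronglyMeasurable p volume := by
  have : Nontrivial (EuclideanSpace ℝ (Fin d)) :=
    Module.nontrivial_of_finrank_pos (R := ℝ) (by rw [finrank_euclideanSpace_fin]; exact hd)
  have h := hp.locallyIntegrable.aestronglyMeasurable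
  rwa [restrict_compl_singleton] at h

/-- The function `|f| ∗ |p̌|`, with values in `[0, ∞]`. -/
def absConv (f p : EuclideanSpace ℝ (Fin d) → ℝ) : EuclideanSpace ℝ (Fin d) → ENNReal :=
  lconvolution (fun x => ‖f x‖ₑ) (fun x => ‖p (-x)‖ₑ) volume

lemma absConv_apply (f p : EuclideanSpace ℝ (Fin d) → ℝ) (x : EuclideanSpace ℝ (Fin d)) :
    absConv f p x = ∫⁻ y, ‖f y * p (-(x - y))‖ₑ := by
  simp only [absConv, lconvolution, enorm_mul, neg_add_eq_sub]

lemma aestronglyMeasurable_comp_neg (hm : AEStronglyMeasurable p volume) :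
    AEStronglyMeasurable (fun x => p (-x)) volume :=
  hm.comp_measurePreserving (Measure.measurePreserving_neg volume)

lemma aemeasurable_absConv (hf : AEStronglyMeasurable f volume)
    (hm : AEStronglyMeasurable p volume) : AEMeasurable (absConv f p) volume :=
  aemeasurable_lconvolution hf.enorm (aestronglyMeasurable_comp_neg hm).enorm

lemma lintegral_enorm_rpow_lt_top (hα : 0 < α) {f : EuclideanSpace ℝ (Fin d) → ℝ}
    (hf : MemLp f (ENNReal.ofReal α) volume) : ∫⁻ x, ‖f x‖ₑ ^ α < ⊤ := by
  have := lintegral_rpow_enorm_lt_top_of_eLpNorm_lt_top (by simpa using hα) (by simp) hf.2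
  rwa [ENNReal.toReal_ofReal hα.le] at this

/-- The kernel splits into a part in `L^1` near the singularity and a part in `L^α` at infinity;
Young's inequality applies to the first because `f ∈ L^α`, to the second because `f ∈ L^1`. -/
lemma lintegral_absConv_rpow_lt_top (hd : 1 ≤ d) (hα : 1 < α) (hβ : (d : ℝ) / α < β)
    (hβd : β < d) (hm : AEStronglyMeasurable p volume)
    (hC : ∀ x, x ≠ 0 → |p x| ≤ C * ‖x‖ ^ (-β))
    (hf : f ∈ lpFunctions α volume) (hf1 : f ∈ lpFunctions 1 volume) :
    ∫⁻ x, absConv f p x ^ α < ⊤ := by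
  have hα0 : 0 < α := zero_lt_one.trans hα
  have hβ0 : 0 ≤ β := le_trans (by positivity) hβ.le
  have hfin : Module.finrank ℝ (EuclideanSpace ℝ (Fin d)) = d := finrank_euclideanSpace_fin
  set p₁ := (Metric.ball 0 1).indicator p with hp₁
  set p₂ := (Metric.ball 0 1)ᶜ.indicator p with hp₂
  have h1 : Integrable p₁ :=
    integrable_indicator_ball (by rwa [hfin]) (by rwa [hfin]) hm hC
  have h2 : MemLp p₂ (ENNReal.ofReal α) volume :=
    memLp_indicator_compl_ball hα0 hβ0 (by rw [hfin]; exact (div_lt_iff₀ hα0).1 hβ) one_pos hm hC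
  have hfm : AEStronglyMeasurable f volume := hf.1
  have hp : ∀ w, ‖p w‖ₑ = ‖p₁ w‖ₑ + ‖p₂ w‖ₑ := fun w => by
    by_cases hw : w ∈ Metric.ball (0 : EuclideanSpace ℝ (Fin d)) 1 <;> simp [hp₁, hp₂, hw]
  have hsplit : ∀ x, absConv f p x = absConv f p₁ x + absConv f p₂ x := fun x => by
    rw [absConv_apply, absConv_apply, absConv_apply, ← lintegral_add_left']
    · simp only [enorm_mul, hp, mul_add]
    · exact (hfm.convolution_integrand_snd (ContinuousLinearMap.mul ℝ ℝ)
        (aestronglyMeasurable_comp_neg h1.1) x).enorm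
  have hneg : ∀ φ : EuclideanSpace ℝ (Fin d) → ENNReal, ∫⁻ x, φ (-x) = ∫⁻ x, φ x := fun φ =>
    lintegral_neg_eq_self φ
  have b1 : ∫⁻ x, absConv f p₁ x ^ α < ⊤ := by
    unfold absConv
    rw [lconvolution_comm]
    refine (lintegral_lconvolution_rpow_le hα (aestronglyMeasurable_comp_neg h1.1).enorm
      hfm.enorm).trans_lt (ENNReal.mul_lt_top ?_ (lintegral_enorm_rpow_lt_top hα0 hf))
    rw [hneg fun x => ‖p₁ x‖ₑ]
    exact ENNReal.rpow_lt_top_of_nonneg hα0.le h1.2.ne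
  have b2 : ∫⁻ x, absConv f p₂ x ^ α < ⊤ := by
    refine (lintegral_lconvolution_rpow_le hα hfm.enorm
      (aestronglyMeasurable_comp_neg h2.1).enorm).trans_lt (ENNReal.mul_lt_top ?_ ?_)
    · have h := lintegral_enorm_rpow_lt_top one_pos hf1
      simp only [ENNReal.rpow_one] at h
      exact ENNReal.rpow_lt_top_of_nonneg hα0.le h.ne
    · rw [hneg fun x => ‖p₂ x‖ₑ ^ α]
      exact lintegral_enorm_rpow_lt_top hα0 h2
  calc ∫⁻ x, absConv f p x ^ α
      ≤ ∫⁻ x, 2 ^ (α - 1) * (absConv f p₁ x ^ α + absConv f p₂ x ^ α) :=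
        lintegral_mono fun x => by
          rw [hsplit]
          exact ENNReal.rpow_add_le_mul_rpow_add_rpow _ _ hα.le
    _ = 2 ^ (α - 1) * ((∫⁻ x, absConv f p₁ x ^ α) + ∫⁻ x, absConv f p₂ x ^ α) := by
        have hm1 := (aemeasurable_absConv hfm h1.1).pow_const α
        have hm2 := (aemeasurable_absConv hfm h2.1).pow_const α
        rw [← lintegral_add_left' hm1]
        exact lintegral_const_mul'' _ (hm1.add hm2)
    _ < ⊤ := ENNReal.mul_lt_top (ENNReal.rpow_lt_top_of_nonneg (by linarith) (by simp))
        (ENNReal.add_lt_top.2 ⟨b1, b2⟩)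

lemma ae_convolutionExistsAt (hα : 0 < α) (hfm : AEStronglyMeasurable f volume)
    (hm : AEStronglyMeasurable p volume) (h : ∫⁻ x, absConv f p x ^ α < ⊤) :
    ∀ᵐ x, ConvolutionExistsAt f (fun y => p (-y)) x (ContinuousLinearMap.mul ℝ ℝ) volume := by
  filter_upwards [ae_lt_top' ((aemeasurable_absConv hfm hm).pow_const α) h.ne] with x hx
  refine ⟨hfm.convolution_integrand_snd _ (aestronglyMeasurable_comp_neg hm) x, ?_⟩
  rw [ENNReal.rpow_lt_top_iff_of_pos hα, absConv_apply] at hx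
  exact hx

lemma aestronglyMeasurable_convReflect (hfm : AEStronglyMeasurable f volume)
    (hm : AEStronglyMeasurable p volume) : AEStronglyMeasurable (convReflect f p) volume :=
  (hfm.convolution_integrand (ContinuousLinearMap.mul ℝ ℝ)
    (aestronglyMeasurable_comp_neg hm)).integral_prod_right'

lemma convReflect_apply (f p : EuclideanSpace ℝ (Fin d) → ℝ) (x : EuclideanSpace ℝ (Fin d)) :
    convReflect f p x = ∫ y, f y * p (y - x) := by
  simp only [convReflect, convolution, ContinuousLinearMap.mul_apply', neg_sub]

lemma enorm_convReflect_le (f p : EuclideanSpace ℝ (Fin d) → ℝ)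
    (x : EuclideanSpace ℝ (Fin d)) : ‖convReflect f p x‖ₑ ≤ absConv f p x := by
  rw [absConv_apply]
  exact enorm_integral_le_lintegral_enorm _

lemma convReflect_mem_lpFunctions (hα : 0 < α) (hfm : AEStronglyMeasurable f volume)
    (hm : AEStronglyMeasurable p volume) (h : ∫⁻ x, absConv f p x ^ α < ⊤) :
    convReflect f p ∈ lpFunctions α volume := by
  refine ⟨aestronglyMeasurable_convReflect hfm hm, ?_⟩
  rw [eLpNorm_lt_top_iff_lintegral_rpow_enorm_lt_top (by simpa using hα) (by simp),
    ENNReal.toReal_ofReal hα.le]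
  exact (lintegral_mono fun x => ENNReal.rpow_le_rpow (enorm_convReflect_le f p x) hα.le).trans_lt h

lemma convReflect_linear_ae
    (hf : ∀ᵐ x, ConvolutionExistsAt f (fun y => p (-y)) x (ContinuousLinearMap.mul ℝ ℝ) volume)
    (hg : ∀ᵐ x, ConvolutionExistsAt g (fun y => p (-y)) x (ContinuousLinearMap.mul ℝ ℝ) volume)
    (a b : ℝ) : convReflect (a • f + b • g) p =ᵐ[volume]
      a • convReflect f p + b • convReflect g p := by
  filter_upwards [hf, hg] with x h1 h2
  have h1' := h1.integrable
  have h2' := h2.integrable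
  simp only [ContinuousLinearMap.mul_apply', neg_sub] at h1' h2'
  simp only [Pi.add_apply, Pi.smul_apply, smul_eq_mul, convReflect_apply]
  rw [← integral_const_mul, ← integral_const_mul, ← integral_add (h1'.const_mul a)
    (h2'.const_mul b)]
  congr with y
  ring

lemma convReflect_comp_add (f p : EuclideanSpace ℝ (Fin d) → ℝ) (u : EuclideanSpace ℝ (Fin d)) :
    convReflect (fun x => f (x + u)) p = fun x => convReflect f p (x + u) := by
  ext x
  rw [convReflect_apply, convReflect_apply,
    ← integral_add_right_eq_self (fun y => f y * p (y - (x + u))) u]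
  simp only [add_sub_add_right_eq_sub]

/-- The homogeneity of `p` fails at `0`, which matters only for `y = x` in the integral. -/
lemma convReflect_comp_smul (hd : 1 ≤ d)
    (hom : ∀ t : ℝ, 0 < t → ∀ x, x ≠ 0 → p (t • x) = t ^ (-β) * p x) {h : ℝ} (hh : 0 < h) :
    convReflect (fun x => f (h • x)) p =
      h ^ (β - d) • fun x => convReflect f p (h • x) := by
  have : Nontrivial (EuclideanSpace ℝ (Fin d)) :=
    Module.nontrivial_of_finrank_pos (R := ℝ) (by rw [finrank_euclideanSpace_fin]; exact hd)
  ext x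
  have key : ∀ᵐ y, f (h • y) * p (y - x) =
      h ^ β * (fun z => f z * p (z - h • x)) (h • y) := by
    filter_upwards [compl_mem_ae_iff.2 (measure_singleton x)] with y hy
    have hne : y - x ≠ 0 := sub_ne_zero.2 hy
    have e := hom h hh (y - x) hne
    rw [← smul_sub, e, Real.rpow_neg hh.le]
    have : h ^ β ≠ 0 := by positivity
    field_simp
  rw [Pi.smul_apply, convReflect_apply, convReflect_apply, integral_congr_ae key,
    integral_const_mul, Measure.integral_comp_smul_of_nonneg volume
      (fun z => f z * p (z - h • x)) h (hR := hh.le), smul_eq_mul,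
    smul_eq_mul, finrank_euclideanSpace_fin, ← mul_assoc, Real.rpow_sub hh, Real.rpow_natCast,
    div_eq_mul_inv]

lemma comp_add_mem_lpFunctions (hf : f ∈ lpFunctions α volume) (u : EuclideanSpace ℝ (Fin d)) :
    (fun x => f (x + u)) ∈ lpFunctions α volume :=
  MemLp.comp_measurePreserving hf (measurePreserving_add_right volume u)

lemma comp_smul_mem_lpFunctions (hf : f ∈ lpFunctions α volume) {h : ℝ} (hh : 0 < h) :
    (fun x => f (h • x)) ∈ lpFunctions α volume := by
  refine MemLp.comp_of_map (f := fun x => h • x) ?_ (by fun_prop)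
  have e := Measure.map_addHaar_smul (volume : Measure (EuclideanSpace ℝ (Fin d))) hh.ne'
  rw [e]
  exact MemLp.smul_measure hf ENNReal.ofReal_ne_top

lemma stableExponent_comp_add (ν : ℝ) (f : EuclideanSpace ℝ (Fin d) → ℝ)
    (u : EuclideanSpace ℝ (Fin d)) :
    stableExponent volume α ν (fun x => f (x + u)) = stableExponent volume α ν f := by
  rw [stableExponent, stableExponent, integral_add_right_eq_self (fun x => |f x| ^ α),
    integral_add_right_eq_self (fun x => Real.sign (f x) * |f x| ^ α)]

lemma stableExponent_comp_smul (ν : ℝ) (f : EuclideanSpace ℝ (Fin d) → ℝ) {h : ℝ} (hh : 0 < h) :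
    stableExponent volume α ν (fun x => f (h • x)) =
      ((h ^ d)⁻¹ : ℝ) * stableExponent volume α ν f := by
  rw [stableExponent, stableExponent,
    Measure.integral_comp_smul_of_nonneg volume (fun x => |f x| ^ α) h (hR := hh.le),
    Measure.integral_comp_smul_of_nonneg volume (fun x => Real.sign (f x) * |f x| ^ α) h
      (hR := hh.le), finrank_euclideanSpace_fin, smul_eq_mul, smul_eq_mul]
  push_cast
  ring

/-! ### The covariance kernel -/

section Covariance

/-- Absolute convergence of the triple integral that links the covariance kernel with
`∫ (f ∗ p̌) (g ∗ p̌)`. -/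
lemma integrable_triple (hfm : AEStronglyMeasurable f volume) (hgm : AEStronglyMeasurable g volume)
    (hm : AEStronglyMeasurable p volume)
    (hf : ∫⁻ x, absConv f p x ^ (2 : ℝ) < ⊤) (hg : ∫⁻ x, absConv g p x ^ (2 : ℝ) < ⊤) :
    Integrable (fun w : EuclideanSpace ℝ (Fin d) ×
      (EuclideanSpace ℝ (Fin d) × EuclideanSpace ℝ (Fin d)) =>
        f w.2.1 * p (-(w.1 - w.2.1)) * (g w.2.2 * p (-(w.1 - w.2.2)))) := by
  have hmeas : ∀ φ : EuclideanSpace ℝ (Fin d) → ℝ, AEStronglyMeasurable φ volume →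
      AEStronglyMeasurable (fun w : EuclideanSpace ℝ (Fin d) × EuclideanSpace ℝ (Fin d) =>
        φ w.2 * p (-(w.1 - w.2))) (volume.prod volume) := fun φ hφ =>
    hφ.convolution_integrand (ContinuousLinearMap.mul ℝ ℝ) (aestronglyMeasurable_comp_neg hm)
  have hassoc := (measurePreserving_prodAssoc (volume : Measure (EuclideanSpace ℝ (Fin d)))
    (volume : Measure (EuclideanSpace ℝ (Fin d)))
    (volume : Measure (EuclideanSpace ℝ (Fin d)))).symm
  have hq1 := Measure.quasiMeasurePreserving_fst.comp hassoc.quasiMeasurePreserving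
  have hq2 := hq1.comp ((MeasurePreserving.id (volume : Measure (EuclideanSpace ℝ (Fin d)))).prod
    (Measure.measurePreserving_swap (μ := (volume : Measure (EuclideanSpace ℝ (Fin d))))
      (ν := (volume : Measure (EuclideanSpace ℝ (Fin d)))))).quasiMeasurePreserving
  have hΦ : AEStronglyMeasurable (fun w : EuclideanSpace ℝ (Fin d) ×
      (EuclideanSpace ℝ (Fin d) × EuclideanSpace ℝ (Fin d)) =>
        f w.2.1 * p (-(w.1 - w.2.1)) * (g w.2.2 * p (-(w.1 - w.2.2))))
        (volume.prod (volume.prod volume)) :=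
    ((hmeas f hfm).comp_quasiMeasurePreserving hq1).mul
      ((hmeas g hgm).comp_quasiMeasurePreserving hq2)
  refine ⟨hΦ, ?_⟩
  change ∫⁻ w, _ ∂(volume.prod (volume.prod volume)) < ⊤
  rw [lintegral_prod _ hΦ.enorm]
  have hinner : ∀ z, ∫⁻ v : EuclideanSpace ℝ (Fin d) × EuclideanSpace ℝ (Fin d),
      ‖f v.1 * p (-(z - v.1)) * (g v.2 * p (-(z - v.2)))‖ₑ ∂(volume.prod volume) =
        (absConv f p * absConv g p) z := fun z => by
    have hs : ∀ φ : EuclideanSpace ℝ (Fin d) → ℝ, AEStronglyMeasurable φ volume →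
        AEMeasurable (fun y => ‖φ y * p (-(z - y))‖ₑ) volume := fun φ hφ =>
      (hφ.convolution_integrand_snd (ContinuousLinearMap.mul ℝ ℝ)
        (aestronglyMeasurable_comp_neg hm) z).enorm
    simp_rw [enorm_mul (f _ * _)]
    rw [lintegral_prod_mul (hs f hfm) (hs g hgm), Pi.mul_apply, absConv_apply, absConv_apply]
  simp_rw [hinner]
  refine (ENNReal.lintegral_mul_le_Lp_mul_Lq volume Real.HolderConjugate.two_two
    (aemeasurable_absConv hfm hm) (aemeasurable_absConv hgm hm)).trans_lt ?_
  exact ENNReal.mul_lt_top (ENNReal.rpow_lt_top_of_nonneg (by norm_num) hf.ne)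
    (ENNReal.rpow_lt_top_of_nonneg (by norm_num) hg.ne)

lemma integral_triple_fst (f g p : EuclideanSpace ℝ (Fin d) → ℝ)
    (v : EuclideanSpace ℝ (Fin d) × EuclideanSpace ℝ (Fin d)) :
    ∫ z, f v.1 * p (-(z - v.1)) * (g v.2 * p (-(z - v.2))) =
      f v.1 * covKernel p v.1 v.2 * g v.2 := by
  rw [covKernel, ← integral_const_mul, ← integral_mul_const]
  congr with z
  rw [neg_sub, neg_sub]
  ring

lemma integrable_mul_covKernel_mul (hfm : AEStronglyMeasurable f volume)
    (hgm : AEStronglyMeasurable g volume) (hm : AEStronglyMeasurable p volume)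
    (hf : ∫⁻ x, absConv f p x ^ (2 : ℝ) < ⊤) (hg : ∫⁻ x, absConv g p x ^ (2 : ℝ) < ⊤) :
    Integrable fun v : EuclideanSpace ℝ (Fin d) × EuclideanSpace ℝ (Fin d) =>
      f v.1 * covKernel p v.1 v.2 * g v.2 := by
  simp_rw [← integral_triple_fst]
  exact (integrable_triple hfm hgm hm hf hg).integral_prod_right

/-- Fubini's theorem: integrating first over `z` gives the kernel, integrating first over `(x, y)`
gives the product of the two convolutions. -/
lemma integral_mul_covKernel_mul (hfm : AEStronglyMeasurable f volume)
    (hgm : AEStronglyMeasurable g volume) (hm : AEStronglyMeasurable p volume)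
    (hf : ∫⁻ x, absConv f p x ^ (2 : ℝ) < ⊤) (hg : ∫⁻ x, absConv g p x ^ (2 : ℝ) < ⊤) :
    ∫ v : EuclideanSpace ℝ (Fin d) × EuclideanSpace ℝ (Fin d),
      f v.1 * covKernel p v.1 v.2 * g v.2 = ∫ z, convReflect f p z * convReflect g p z := by
  simp_rw [← integral_triple_fst]
  rw [← integral_integral_swap (f := fun (z : EuclideanSpace ℝ (Fin d))
    (v : EuclideanSpace ℝ (Fin d) × EuclideanSpace ℝ (Fin d)) =>
      f v.1 * p (-(z - v.1)) * (g v.2 * p (-(z - v.2)))) (integrable_triple hfm hgm hm hf hg)]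
  congr with z
  exact integral_prod_mul (fun y => f y * p (-(z - y))) (fun y => g y * p (-(z - y)))

end Covariance

end FractionalKernel

/-! ### The fractional noise -/

section FractionalNoise

variable {d : ℕ} {Ω : Type*} [MeasurableSpace Ω] {P : Measure Ω} [IsProbabilityMeasure P]
  {α β ν : ℝ} {p : EuclideanSpace ℝ (Fin d) → ℝ} {W : (EuclideanSpace ℝ (Fin d) → ℝ) → Ω → ℝ}
  {F : Submodule ℝ (EuclideanSpace ℝ (Fin d) → ℝ)}

lemma isRandomNoise_fractionalNoise (hα : 0 < α)
    (hW : IsStableWhiteNoise volume α (fun _ => ν) W P)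
    (hmem : ∀ f ∈ F, convReflect f p ∈ lpFunctions α volume)
    (hex : ∀ f ∈ F, ∀ᵐ x,
      ConvolutionExistsAt f (fun y => p (-y)) x (ContinuousLinearMap.mul ℝ ℝ) volume) :
    IsRandomNoise F (fractionalNoise W p) P where
  aemeasurable f hf := hW.isRandomNoise.aemeasurable _ (hmem f hf)
  linear f hf g hg a b := by
    have h1 := hW.ae_eq_of_ae_eq hα
      (hmem _ (F.add_mem (F.smul_mem a hf) (F.smul_mem b hg)))
      (Submodule.add_mem _ (Submodule.smul_mem _ a (hmem f hf))
        (Submodule.smul_mem _ b (hmem g hg)))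
      (convReflect_linear_ae (hex f hf) (hex g hg) a b)
    exact h1.trans (hW.isRandomNoise.linear _ (hmem f hf) _ (hmem g hg) a b)

lemma isStationary_fractionalNoise (hα : 0 < α)
    (hW : IsStableWhiteNoise volume α (fun _ => ν) W P)
    (hmem : ∀ f ∈ F, convReflect f p ∈ lpFunctions α volume)
    (hF : ∀ u : EuclideanSpace ℝ (Fin d), ∀ f ∈ F, (fun x => f (x + u)) ∈ F) :
    IsStationary F (fractionalNoise W p) P := by
  refine ⟨hF, fun u n f hf => ?_⟩
  refine hW.identDistrib hα (fun i => convReflect (fun x => f i (x + u)) p)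
    (fun i => convReflect (f i) p) (fun i => hmem _ (hF u _ (hf i))) (fun i => hmem _ (hf i))
    fun a => ?_
  rw [← stableExponent_comp_add ν (∑ i, a i • convReflect (f i) p) u]
  congr 1
  ext x
  simp [convReflect_comp_add]

/-- Dilating the integrand multiplies `f ∗ p̌` by `h ^ (β - d)` and dilates it, and the dilation
multiplies the exponent by `h ^ (-d)`; the index `H` compensates both factors. -/
lemma isSelfSimilar_fractionalNoise (hd : 1 ≤ d) (hα : 0 < α)
    (hW : IsStableWhiteNoise volume α (fun _ => ν) W P)
    (hom : ∀ t : ℝ, 0 < t → ∀ x, x ≠ 0 → p (t • x) = t ^ (-β) * p x)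
    (hmem : ∀ f ∈ F, convReflect f p ∈ lpFunctions α volume)
    (hF : ∀ h : ℝ, 0 < h → ∀ f ∈ F, (fun x => f (h • x)) ∈ F) :
    IsSelfSimilar (d / α - β + d) F (fractionalNoise W p) P := by
  refine ⟨hF, fun h hh n f hf => ?_⟩
  have hmem' : ∀ i, convReflect (fun x => f i (h • x)) p ∈ lpFunctions α volume :=
    fun i => hmem _ (hF h hh _ (hf i))
  have hlaw := hW.identDistrib hα
    (fun i => h ^ (d / α - β + d) • convReflect (fun x => f i (h • x)) p)
    (fun i => convReflect (f i) p) (fun i => Submodule.smul_mem _ _ (hmem' i))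
    (fun i => hmem _ (hf i)) fun a => by
      have e : ∑ i, a i • h ^ (d / α - β + d) • convReflect (fun x => f i (h • x)) p =
          h ^ (d / α) • fun x => (∑ i, a i • convReflect (f i) p) (h • x) := by
        ext x
        have hexp : h ^ (d / α) = h ^ (d / α - β + d) * h ^ (β - d) := by
          rw [← Real.rpow_add hh]
          ring_nf
        simp only [convReflect_comp_smul hd hom hh, Finset.sum_apply, Pi.smul_apply, smul_eq_mul,
          Finset.mul_sum, hexp]
        exact Finset.sum_congr rfl fun i _ => by ring
      have hpow : (h ^ (d / α)) ^ α = h ^ d := by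
        rw [← Real.rpow_mul hh.le, div_mul_cancel₀ _ hα.ne', Real.rpow_natCast]
      rw [e, stableExponent_smul_of_pos _ (by positivity), stableExponent_comp_smul ν _ hh,
        hpow, ← mul_assoc, ← Complex.ofReal_mul, mul_inv_cancel₀ (by positivity),
        Complex.ofReal_one, one_mul]
  refine IdentDistrib.trans (IdentDistrib.of_ae_eq ?_ ?_) hlaw
  · exact aemeasurable_pi_iff.2 fun i =>
      (hW.isRandomNoise.aemeasurable _ (hmem' i)).const_mul _
  · have := ae_all_iff.2 fun i => hW.isRandomNoise.smul (hmem' i) (h ^ (d / α - β + d))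
    filter_upwards [this] with ω hω
    ext i
    exact (hω i).symm

lemma isCenteredGaussianNoise_fractionalNoise
    (hW : IsStableWhiteNoise volume 2 (fun _ => ν) W P)
    (hnoise : IsRandomNoise F (fractionalNoise W p) P)
    (hm : AEStronglyMeasurable p volume) (hFm : ∀ f ∈ F, AEStronglyMeasurable f volume)
    (hF : ∀ f ∈ F, ∫⁻ x, absConv f p x ^ (2 : ℝ) < ⊤) :
    IsCenteredGaussianNoise F (fractionalNoise W p) (fun x y => 2 * covKernel p x y) P := by
  have hmem : ∀ f ∈ F, convReflect f p ∈ lpFunctions 2 volume := fun f hf =>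
    convReflect_mem_lpFunctions two_pos (hFm f hf) hm (hF f hf)
  have h2 : ∀ f g : EuclideanSpace ℝ (Fin d) → ℝ, ∀ z : EuclideanSpace ℝ (Fin d) × _,
      f z.1 * (2 * covKernel p z.1 z.2) * g z.2 =
        2 * (f z.1 * covKernel p z.1 z.2 * g z.2) := fun f g z => by ring
  refine ⟨hnoise, ⟨fun I => ?_⟩, fun f hf => hW.integral_eq_zero (hmem f hf),
    fun f hf g hg => ?_, fun f hf g hg => ?_⟩
  · exact hW.hasGaussianLaw_pi (fun i : I => convReflect (i : F) p) fun i => hmem _ (i : F).2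
  · simp_rw [h2]
    exact (integrable_mul_covKernel_mul (hFm f hf) (hFm g hg) hm (hF f hf) (hF g hg)).const_mul 2
  · simp_rw [h2]
    rw [integral_const_mul,
      integral_mul_covKernel_mul (hFm f hf) (hFm g hg) hm (hF f hf) (hF g hg)]
    exact hW.integral_mul (hmem f hf) (hmem g hg)

end FractionalNoise

end StableNoise

end

theorem mainTheorem7 {d : ℕ} {Ω : Type*} [MeasurableSpace Ω] (P : Measure Ω)
    [IsProbabilityMeasure P] (α β ν : ℝ) (hα : 1 < α) (hα2 : α ≤ 2)
    (hβ : (d : ℝ) / α < β) (hβd : β < d) (hν : ν ∈ Set.Icc (-1 : ℝ) 1)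
    (c : (Fin d → ℤ) → ℝ) (hc : Summable fun k => |c k| ^ α)
    (p : EuclideanSpace ℝ (Fin d) → ℝ) (hp : StableNoise.IsRegularlyVarying β c p)
    (W : (EuclideanSpace ℝ (Fin d) → ℝ) → Ω → ℝ)
    (hW : StableNoise.IsStableWhiteNoise volume α (fun _ => ν) W P)
    (F : Submodule ℝ (EuclideanSpace ℝ (Fin d) → ℝ))
    (hF : F = StableNoise.lpFunctions α volume ⊓ StableNoise.lpFunctions 1 volume) :
    -- the noise is well defined on `L^α ∩ L^1`
    (∀ f ∈ F,
      (∀ᵐ x, ConvolutionExistsAt f (fun y => p (-y)) x (ContinuousLinearMap.mul ℝ ℝ) volume) ∧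
      StableNoise.convReflect f p ∈ StableNoise.lpFunctions α volume) ∧
    StableNoise.IsRandomNoise F (StableNoise.fractionalNoise W p) P ∧
    -- it is `α`-stable
    StableNoise.IsStableProcess α F (StableNoise.fractionalNoise W p) P ∧
    (∀ f ∈ F, ∃ σ ν' : ℝ, 0 ≤ σ ∧ ν' ∈ Set.Icc (-1 : ℝ) 1 ∧
      StableNoise.HasStableLaw (StableNoise.fractionalNoise W p f) α σ ν' P) ∧
    -- it is stationary and self-similar
    StableNoise.IsStationary F (StableNoise.fractionalNoise W p) P ∧
    StableNoise.IsSelfSimilar (d / α - β + d) F (StableNoise.fractionalNoise W p) P ∧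
    -- the Gaussian case; `S_2(σ, 0)` has variance `2 σ ^ 2`, and `W / √2` is the isometric noise
    (α = 2 →
      (∀ x y, x ≠ y → Integrable fun z => p (x - z) * p (y - z)) ∧
      StableNoise.IsCenteredGaussianNoise F (StableNoise.fractionalNoise W p)
        (fun x y => 2 * StableNoise.covKernel p x y) P ∧
      (∀ g ∈ StableNoise.lpFunctions 2 volume,
        ∫ ω, (W g ω / √2) ^ 2 ∂P = ∫ x, g x ^ 2) ∧
      StableNoise.IsCenteredGaussianNoise F
        (StableNoise.fractionalNoise (fun g ω => W g ω / √2) p)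
        (StableNoise.covKernel p) P) := by
  have hα0 : 0 < α := zero_lt_one.trans hα
  -- `d / α < β < d` is impossible for `d = 0`
  have hd : 1 ≤ d := by
    rcases Nat.eq_zero_or_pos d with rfl | h
    · rw [Nat.cast_zero, zero_div] at hβ
      rw [Nat.cast_zero] at hβd
      exact absurd (hβ.trans hβd) (lt_irrefl _)
    · exact h
  have hβ0 : 0 ≤ β := le_trans (by positivity) hβ.le
  have hm := hp.aestronglyMeasurable hd
  obtain ⟨C, hC⟩ := hp.exists_abs_le hα0 hc
  subst hF
  have hconv : ∀ f ∈ StableNoise.lpFunctions α volume ⊓ StableNoise.lpFunctions 1 volume,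
      ∫⁻ x, StableNoise.absConv f p x ^ α < ⊤ := fun f hf =>
    StableNoise.lintegral_absConv_rpow_lt_top hd hα hβ hβd hm hC hf.1 hf.2
  have hmem : ∀ f ∈ StableNoise.lpFunctions α volume ⊓ StableNoise.lpFunctions 1 volume,
      StableNoise.convReflect f p ∈ StableNoise.lpFunctions α volume := fun f hf =>
    StableNoise.convReflect_mem_lpFunctions hα0 hf.1.1 hm (hconv f hf)
  have hex : ∀ f ∈ StableNoise.lpFunctions α volume ⊓ StableNoise.lpFunctions 1 volume,
      ∀ᵐ x, ConvolutionExistsAt f (fun y => p (-y)) x (ContinuousLinearMap.mul ℝ ℝ) volume :=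
    fun f hf => StableNoise.ae_convolutionExistsAt hα0 hf.1.1 hm (hconv f hf)
  have hnoise := StableNoise.isRandomNoise_fractionalNoise hα0 hW hmem hex
  refine ⟨fun f hf => ⟨hex f hf, hmem f hf⟩, hnoise, fun n f hf => ?_, fun f hf => ?_, ?_, ?_, ?_⟩
  · exact ⟨hnoise.aemeasurable_pi f hf,
      hW.isStableLaw_map hα0 (fun i => StableNoise.convReflect (f i) p) fun i => hmem _ (hf i)⟩
  · exact ⟨_, _, StableNoise.scale_nonneg _ _ _,
      StableNoise.skewness_mem_Icc hα0 hν (hmem f hf), hW.hasStableLaw _ (hmem f hf)⟩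
  · exact StableNoise.isStationary_fractionalNoise hα0 hW hmem fun u f hf =>
      ⟨StableNoise.comp_add_mem_lpFunctions hf.1 u, StableNoise.comp_add_mem_lpFunctions hf.2 u⟩
  · exact StableNoise.isSelfSimilar_fractionalNoise hd hα0 hW hp.homogeneous hmem
      fun h hh f hf => ⟨StableNoise.comp_smul_mem_lpFunctions hf.1 hh,
        StableNoise.comp_smul_mem_lpFunctions hf.2 hh⟩
  · rintro rfl
    have hgauss := StableNoise.isCenteredGaussianNoise_fractionalNoise hW hnoise hm
      (fun f hf => hf.1.1) hconv
    have hdiv : ∀ r : ℝ, (√2)⁻¹ * r = r / √2 := fun r => by rw [inv_mul_eq_div]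
    have hsq : (√2)⁻¹ ^ 2 = (2 : ℝ)⁻¹ := by rw [inv_pow, Real.sq_sqrt zero_le_two]
    refine ⟨fun x y hxy => ?_, hgauss, fun g hg => ?_, ?_⟩
    · have hfin : Module.finrank ℝ (EuclideanSpace ℝ (Fin d)) = d := finrank_euclideanSpace_fin
      exact StableNoise.integrable_mul_comp_sub (by rwa [hfin]) hβ0 (by rwa [hfin])
        (by rw [hfin]; exact (div_lt_iff₀ two_pos).1 hβ) hm hC hxy
    · simp_rw [div_pow, Real.sq_sqrt zero_le_two]
      rw [integral_div, hW.integral_sq hg, mul_div_cancel_left₀ _ two_ne_zero]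
    · have h := hgauss.const_mul (√2)⁻¹
      simp only [hsq, inv_mul_cancel_left₀ (two_ne_zero' ℝ), hdiv] at h
      exact h
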